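/- For a complex Hilbert space $H$ let $P(H)$ be the set of its rays $[\psi]=\{\lambda\psi \mid \lambda\in\mathbb{C}\}$ ($\psi\in H\setminus\{0\}$), let $L(H)$ be the set of its closed subspaces, and let $\bar e_H : P(H)\times L(H)\to[0,1]$, $\bar e_H([\psi],S)=\|P_S\psi\|^2/\|\psi\|^2$, where $P_S$ is the orthogonal projector onto $S$. A Chu morphism $(P(H),L(H),\bar e_H)\to(P(K),L(K),\bar e_K)$ is a pair of functions $f_*:P(H)\to P(K)$, $f^*:L(K)\to L(H)$ with $\bar e_H(x,f^*(T))=\bar e_K(f_*(x),T)$ for all $x\in P(H)$, $T\in L(K)$. A map $U:H\to K$ is semiunitary if it is bijective and $U(\phi+\psi)=U\phi+U\psi$, $U(\lambda\phi)=\sigma(\lambda)U\phi$ and $\langle U\phi, U\psi\rangle=\sigma(\langle\phi,\psi\rangle)$ for all $\phi,\psi\in H$, $\lambda\in\mathbb{C}$, where $\sigma$ is either the identity ($U$ is unitary) or complex conjugation ($U$ is antiunitary); it induces $P(U):P(H)\to P(K)$, $P(U)([\psi])=[U\psi]$. Theorem. Let $H$ and $K$ be complex Hilbert spaces of dimension greater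 than $2$, and let $(f_*,f^*):(P(H),L(H),\bar e_H)\to(P(K),L(K),\bar e_K)$ be a Chu morphism with $f_*$ injective. Then there is a semiunitary $U:H\to K$ such that $f_*=P(U)$. Moreover, $U$ is unique up to a phase: the semiunitaries $V:H\to K$ with $f_*=P(V)$ are exactly the maps $V=\lambda U$ with $\lambda\in\mathbb{C}$, $|\lambda|=1$. -/

import Mathlib

open scoped LinearAlgebra.Projectivization

noncomputable section

/-- A Chu space over a set `V` of values: a set of points, a set of attributes, and an
evaluation function. -/
structure ChuSpace (V : Type*) where
  Point : Type*
  Attr : Type*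
  eval : Point → Attr → V

/-- A morphism of Chu spaces: a forward map `f_*` on points and a backward map `f^*` on
attributes with `e (x, f^* a') = e' (f_* x, a')`. -/
structure ChuSpace.Hom {V : Type*} (C D : ChuSpace V) where
  onPoint : C.Point → D.Point
  onAttr : D.Attr → C.Attr
  adj : ∀ (x : C.Point) (a : D.Attr), C.eval x (onAttr a) = D.eval (onPoint x) a

section Eval

variable {H : Type*} [NormedAddCommGroup H] [InnerProductSpace ℂ H] [CompleteSpace H]

instance ClosedSubmodule.hasOrthogonalProjection_toSubmodule (S : ClosedSubmodule ℂ H) :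
    S.toSubmodule.HasOrthogonalProjection :=
  haveI : CompleteSpace S.toSubmodule := S.isClosed'.completeSpace_coe
  inferInstance

/-- The statistical algorithm `‖P_S ψ‖² / ‖ψ‖²` on vectors, where `P_S` is the orthogonal
projector onto `S`. It is only used at `ψ ≠ 0`. -/
def bornProb (ψ : H) (S : ClosedSubmodule ℂ H) : ℝ :=
  ‖S.toSubmodule.starProjection ψ‖ ^ 2 / ‖ψ‖ ^ 2

theorem bornProb_mem (ψ : H) (S : ClosedSubmodule ℂ H) : bornProb ψ S ∈ unitInterval := by
  refine ⟨by unfold bornProb; positivity, div_le_one_of_le₀ ?_ (by positivity)⟩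
  gcongr
  exact S.toSubmodule.norm_starProjection_apply_le ψ

theorem bornProb_smul {t : ℂ} (ht : t ≠ 0) (ψ : H) (S : ClosedSubmodule ℂ H) :
    bornProb (t • ψ) S = bornProb ψ S := by
  have : ‖t‖ ≠ 0 := norm_ne_zero_iff.mpr ht
  simp only [bornProb, map_smul, norm_smul, mul_pow]
  exact mul_div_mul_left _ _ (pow_ne_zero 2 this)

/-- The evaluation `ē` on rays and closed subspaces, with values in the unit interval:
`ē ([ψ], S) = ‖P_S ψ‖² / ‖ψ‖²`. -/
def rayEval (x : ℙ ℂ H) (S : ClosedSubmodule ℂ H) : unitInterval :=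
  Projectivization.lift (fun ψ : {v : H // v ≠ 0} => (⟨bornProb ψ.1 S, bornProb_mem ψ.1 S⟩ : unitInterval))
    (by
      intro a b t h
      have ht : t ≠ 0 := by
        rintro rfl
        exact a.2 (by rw [h, zero_smul])
      exact Subtype.ext (by simp only [h, bornProb_smul ht]))
    x

end Eval

/-- The biextensional quantum Chu space `(P(H), L(H), ē)` over `[0, 1]`: points are the rays of
`H`, attributes are the closed subspaces of `H`. -/
def quantumChu (H : Type*) [NormedAddCommGroup H] [InnerProductSpace ℂ H] [CompleteSpace H] :
    ChuSpace unitInterval where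
  Point := ℙ ℂ H
  Attr := ClosedSubmodule ℂ H
  eval := rayEval

section Semiunitary

variable {H K : Type*} [NormedAddCommGroup H] [InnerProductSpace ℂ H]
  [NormedAddCommGroup K] [InnerProductSpace ℂ K]

/-- `U` is a bijective `σ`-semilinear map with `⟪U φ, U ψ⟫ = σ ⟪φ, ψ⟫`. -/
structure IsSemiunitaryWith (σ : ℂ →+* ℂ) (U : H → K) : Prop where
  bijective : Function.Bijective U
  map_add : ∀ φ ψ : H, U (φ + ψ) = U φ + U ψ
  map_smul : ∀ (c : ℂ) (φ : H), U (c • φ) = σ c • U φ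
  inner_map : ∀ φ ψ : H, inner ℂ (U φ) (U ψ) = σ (inner ℂ φ ψ)

/-- Unitary maps between two Hilbert spaces. -/
def IsUnitaryMap (U : H → K) : Prop := IsSemiunitaryWith (RingHom.id ℂ) U

/-- Antiunitary maps between two Hilbert spaces. -/
def IsAntiunitaryMap (U : H → K) : Prop := IsSemiunitaryWith (starRingEnd ℂ) U

/-- Semiunitary maps: unitary or antiunitary. -/
def IsSemiunitary (U : H → K) : Prop := IsUnitaryMap U ∨ IsAntiunitaryMap U

theorem IsSemiunitaryWith.map_ne_zero {σ : ℂ →+* ℂ} {U : H → K} (hU : IsSemiunitaryWith σ U)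
    {ψ : H} (hψ : ψ ≠ 0) : U ψ ≠ 0 := by
  have h0 : U 0 = 0 := by simpa using hU.map_smul 0 0
  exact fun h => hψ (hU.bijective.1 (h.trans h0.symm))

theorem IsSemiunitary.map_ne_zero {U : H → K} (hU : IsSemiunitary U)
    {ψ : H} (hψ : ψ ≠ 0) : U ψ ≠ 0 :=
  hU.elim (fun h => IsSemiunitaryWith.map_ne_zero h hψ) (fun h => IsSemiunitaryWith.map_ne_zero h hψ)

theorem IsSemiunitary.exists_map_smul {U : H → K} (hU : IsSemiunitary U) (c : ℂ) (ψ : H) :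
    ∃ d : ℂ, d • U ψ = U (c • ψ) :=
  hU.elim (fun h => ⟨_, (IsSemiunitaryWith.map_smul h c ψ).symm⟩)
    (fun h => ⟨_, (IsSemiunitaryWith.map_smul h c ψ).symm⟩)

/-- The induced map `P(U)` on rays, `[ψ] ↦ [U ψ]`. -/
def IsSemiunitary.rayMap {U : H → K} (hU : IsSemiunitary U) : ℙ ℂ H → ℙ ℂ K :=
  Projectivization.lift (fun ψ : {v : H // v ≠ 0} => Projectivization.mk ℂ (U ψ.1) (hU.map_ne_zero ψ.2))
    (by
      intro a b t h
      refine (Projectivization.mk_eq_mk_iff' ℂ _ _ _ _).mpr ?_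
      rw [h]
      exact hU.exists_map_smul t b)

end Semiunitary

end

theorem exists_unit_smul_of_norm_inner_eq {K : Type*} [NormedAddCommGroup K]
    [InnerProductSpace ℂ K] {x y : K} (hxy : ‖y‖ = ‖x‖) (h : ‖inner ℂ x y‖ = ‖x‖ * ‖y‖) :
    ∃ c : ℂ, ‖c‖ = 1 ∧ y = c • x := by
  by_cases hx : x = 0
  · exact ⟨1, by simp, by simpa [hx] using hxy⟩
  have hy : y ≠ 0 := by
    rintro rfl
    exact hx (by simpa using hxy.symm)
  obtain ⟨r, -, hr⟩ := (norm_inner_eq_norm_iff (𝕜 := ℂ) hx hy).1 h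
  refine ⟨r, ?_, hr⟩
  rw [hr, norm_smul] at hxy
  exact (mul_eq_right₀ (norm_ne_zero_iff.2 hx)).1 hxy

theorem re_eq_of_norm_eq_of_norm_one_add_eq {z w : ℂ} (h : ‖z‖ = ‖w‖)
    (h1 : ‖1 + z‖ = ‖1 + w‖) : z.re = w.re := by
  have e1 : Complex.normSq z = Complex.normSq w := by
    rw [Complex.normSq_eq_norm_sq, Complex.normSq_eq_norm_sq, h]
  have e2 : Complex.normSq (1 + z) = Complex.normSq (1 + w) := by
    rw [Complex.normSq_eq_norm_sq, Complex.normSq_eq_norm_sq, h1]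
  simp only [Complex.normSq_apply, Complex.add_re, Complex.add_im, Complex.one_re,
    Complex.one_im] at e1 e2
  linarith

theorem forall_eq_zero_or_forall_eq_zero {A B : Type*} [AddGroup A] [AddGroup B] (f g : A →+ B)
    (h : ∀ x, f x = 0 ∨ g x = 0) : (∀ x, f x = 0) ∨ ∀ x, g x = 0 := by
  by_contra! hc
  obtain ⟨⟨x, hx⟩, y, hy⟩ := hc
  have hx' := (h x).resolve_left hx
  have hy' := (h y).resolve_right hy
  rcases h (x + y) with h | h
  · exact hx (by simpa [hy'] using h)
  · exact hy (by simpa [hx'] using h)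

section RealPart

variable {E K : Type*} [NormedAddCommGroup E] [InnerProductSpace ℂ E]
  [NormedAddCommGroup K] [InnerProductSpace ℂ K]

theorem isometry_of_re_inner_eq {g : E → K}
    (hre : ∀ x y, (inner ℂ (g x) (g y)).re = (inner ℂ x y).re) : Isometry g := by
  have hn : ∀ x, ‖g x‖ ^ 2 = ‖x‖ ^ 2 := fun x => by
    rw [← inner_self_eq_norm_sq (𝕜 := ℂ), ← inner_self_eq_norm_sq (𝕜 := ℂ)]
    exact hre x x
  refine Isometry.of_dist_eq fun x y => ?_
  rw [dist_eq_norm, dist_eq_norm, ← sq_eq_sq₀ (norm_nonneg _) (norm_nonneg _),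
    @norm_sub_sq ℂ, @norm_sub_sq ℂ, hn, hn]
  have := hre x y
  simp only [RCLike.re_to_complex, this]

theorem exists_linearIsometry_of_re_inner_eq {g : E → K}
    (hre : ∀ x y, (inner ℂ (g x) (g y)).re = (inner ℂ x y).re) :
    ∃ G : E →ₗ[ℝ] K, ∀ x, G x = g x := by
  have : UniformConvexSpace K :=
    let _ := InnerProductSpace.rclikeToReal ℂ K
    InnerProductSpace.toUniformConvexSpace
  have hi := isometry_of_re_inner_eq hre
  have h0 : g 0 = 0 := by
    have := hre 0 0
    rw [inner_zero_left, ← RCLike.re_to_complex, inner_self_eq_norm_sq] at this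
    simpa using this
  let A := hi.affineIsometryOfStrictConvexSpace
  refine ⟨A.linear, fun x => ?_⟩
  have := A.toAffineMap.map_vadd 0 x
  simpa [A, h0] using this.symm

/-- A map that preserves the real part of the inner product and maps `i x` into the complex line
of the image of `x` is linear or antilinear. -/
theorem semilinear_of_re_inner_eq {g : E → K}
    (hre : ∀ x y, (inner ℂ (g x) (g y)).re = (inner ℂ x y).re)
    (hI : ∀ x, ∃ c : ℂ, ‖c‖ = 1 ∧ g (Complex.I • x) = c • g x) :
    ∃ σ : ℂ →+* ℂ, (σ = RingHom.id ℂ ∨ σ = starRingEnd ℂ) ∧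
      (∀ x y, g (x + y) = g x + g y) ∧ (∀ (c : ℂ) x, g (c • x) = σ c • g x) ∧
      ∀ x y, inner ℂ (g x) (g y) = σ (inner ℂ x y) := by
  obtain ⟨G, hG⟩ := exists_linearIsometry_of_re_inner_eq hre
  have hadd : ∀ x y, g (x + y) = g x + g y := fun x y => by simp only [← hG, map_add]
  have hreal : ∀ (r : ℝ) x, g ((r : ℂ) • x) = (r : ℂ) • g x := fun r x => by
    rw [Complex.coe_smul, Complex.coe_smul, ← hG, ← hG, map_smul]
  have hsplit : ∀ x, g (Complex.I • x) = Complex.I • g x ∨ g (Complex.I • x) = -Complex.I • g x := by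
    intro x
    obtain ⟨c, hc, hx⟩ := hI x
    by_cases h0 : g x = 0
    · left; rw [hx, h0, smul_zero, smul_zero]
    have h1 := hre x (Complex.I • x)
    have h2 : (inner ℂ (g x) (g x)) = ((‖g x‖ ^ 2 : ℝ) : ℂ) := by
      rw [inner_self_eq_norm_sq_to_K]; push_cast; rfl
    have h3 : (inner ℂ x x) = ((‖x‖ ^ 2 : ℝ) : ℂ) := by
      rw [inner_self_eq_norm_sq_to_K]; push_cast; rfl
    rw [hx, inner_smul_right, inner_smul_right, h2, h3, Complex.re_mul_ofReal,
      Complex.re_mul_ofReal, Complex.I_re, zero_mul] at h1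
    have hcre : c.re = 0 := (mul_eq_zero.1 h1).resolve_right
      (pow_ne_zero 2 (norm_ne_zero_iff.2 h0))
    have hc2 : c.re * c.re + c.im * c.im = 1 := by
      rw [← Complex.normSq_apply, Complex.normSq_eq_norm_sq, hc, one_pow]
    rw [hcre, mul_zero, zero_add] at hc2
    rw [hx]
    rcases mul_self_eq_one_iff.1 hc2 with h | h
    · left; congr 1; apply Complex.ext <;> simp [hcre, h]
    · right; congr 1; apply Complex.ext <;> simp [hcre, h]
  have key : ∃ σ : ℂ →+* ℂ, (σ = RingHom.id ℂ ∨ σ = starRingEnd ℂ) ∧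
      ∀ x, g (Complex.I • x) = σ Complex.I • g x := by
    let g' : E →+ K := AddMonoidHom.mk' g hadd
    let J : E →+ E := AddMonoidHom.mk' (fun x => Complex.I • x) (smul_add _)
    let J' : K →+ K := AddMonoidHom.mk' (fun x => Complex.I • x) (smul_add _)
    rcases forall_eq_zero_or_forall_eq_zero (g'.comp J - J'.comp g') (g'.comp J + J'.comp g')
      (fun x => by
        rcases hsplit x with h | h
        · left; simp [g', J, J', h]
        · right; simp [g', J, J', h]) with h | h
    · exact ⟨RingHom.id ℂ, Or.inl rfl, fun x => sub_eq_zero.1 (h x)⟩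
    · refine ⟨starRingEnd ℂ, Or.inr rfl, fun x => ?_⟩
      rw [Complex.conj_I, neg_smul]
      exact eq_neg_of_add_eq_zero_left (h x)
  obtain ⟨σ, hσ, hσI⟩ := key
  have hσr : ∀ r : ℝ, σ (r : ℂ) = r := by
    rcases hσ with rfl | rfl
    · exact fun r => rfl
    · exact Complex.conj_ofReal
  have hsmul : ∀ (c : ℂ) x, g (c • x) = σ c • g x := by
    intro c x
    conv_lhs => rw [← Complex.re_add_im c, add_smul, mul_smul, hadd, hreal, hreal, hσI]
    conv_rhs => rw [← Complex.re_add_im c, map_add, map_mul, hσr, hσr, add_smul, mul_smul]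
  refine ⟨σ, hσ, hadd, hsmul, fun x y => ?_⟩
  have h1 := hre x y
  have h2 := hre x (Complex.I • y)
  rw [hσI, inner_smul_right, inner_smul_right] at h2
  rcases hσ with rfl | rfl
  · apply Complex.ext
    · exact h1
    · simpa using h2
  · apply Complex.ext
    · rw [Complex.conj_re]; exact h1
    · simp only [Complex.conj_I, Complex.mul_re, Complex.neg_re, Complex.neg_im, Complex.I_re,
        Complex.I_im] at h2
      rw [Complex.conj_im]
      linarith

end RealPart

/-- Wigner's theorem: a map of vectors preserving the modulus of inner products is equal up to
phases to a linear or antilinear isometry. -/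
theorem exists_semilinear_isometry_of_norm_inner_eq {H K : Type*}
    [NormedAddCommGroup H] [InnerProductSpace ℂ H] [NormedAddCommGroup K] [InnerProductSpace ℂ K]
    (F : H → K) (hF : ∀ x y, ‖inner ℂ (F x) (F y)‖ = ‖inner ℂ x y‖) (e : H) (he : ‖e‖ = 1) :
    ∃ (σ : ℂ →+* ℂ) (U : H → K), (σ = RingHom.id ℂ ∨ σ = starRingEnd ℂ) ∧
      (∀ x y, U (x + y) = U x + U y) ∧ (∀ (c : ℂ) x, U (c • x) = σ c • U x) ∧
      (∀ x y, inner ℂ (U x) (U y) = σ (inner ℂ x y)) ∧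
      ∀ x, ∃ c : ℂ, ‖c‖ = 1 ∧ U x = c • F x := by
  have hFn : ∀ x, ‖F x‖ = ‖x‖ := fun x => by
    have := hF x x
    rw [inner_self_eq_norm_sq_to_K, inner_self_eq_norm_sq_to_K] at this
    simpa using this
  set e' := F e with he'
  have hee : inner ℂ e e = 1 := by rw [inner_self_eq_norm_sq_to_K, he]; simp
  have hee' : inner ℂ e' e' = 1 := by rw [inner_self_eq_norm_sq_to_K, hFn, he]; simp
  let E := (ℂ ∙ e)ᗮ
  have hE : ∀ ψ : E, inner ℂ e (ψ : H) = 0 := fun ψ =>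
    Submodule.mem_orthogonal_singleton_iff_inner_right.1 ψ.2
  have hE' : ∀ ψ : E, inner ℂ (ψ : H) e = 0 := fun ψ =>
    Submodule.mem_orthogonal_singleton_iff_inner_left.1 ψ.2
  have hphase : ∀ ψ : E, ∃ (k : K) (a : ℂ), ‖a‖ = 1 ∧ e' + k = a • F (e + ψ) ∧
      inner ℂ e' k = 0 := by
    intro ψ
    have ha : ‖inner ℂ e' (F (e + ψ))‖ = 1 := by
      rw [hF, inner_add_right, hee, hE, add_zero, norm_one]
    have ha0 : inner ℂ e' (F (e + ψ)) ≠ 0 := norm_ne_zero_iff.1 (by rw [ha]; exact one_ne_zero)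
    refine ⟨(inner ℂ e' (F (e + ψ)))⁻¹ • F (e + ψ) - e', (inner ℂ e' (F (e + ψ)))⁻¹,
      by rw [norm_inv, ha, inv_one], by abel, ?_⟩
    rw [inner_sub_right, inner_smul_right, hee', inv_mul_cancel₀ ha0, sub_self]
  choose g a ha hg hge using hphase
  have hge' : ∀ ψ, inner ℂ (g ψ) e' = 0 := fun ψ => inner_eq_zero_symm.1 (hge ψ)
  have hone : ∀ ψ φ, ‖1 + inner ℂ (g ψ) (g φ)‖ = ‖1 + inner ℂ ψ φ‖ := by
    intro ψ φ
    have h1 : inner ℂ (e' + g ψ) (e' + g φ) = 1 + inner ℂ (g ψ) (g φ) := by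
      simp only [inner_add_left, inner_add_right, hee', hge, hge', add_zero, zero_add]
    have h2 : inner ℂ (e + (ψ : H)) (e + (φ : H)) = 1 + inner ℂ ψ φ := by
      simp only [inner_add_left, inner_add_right, hee, hE, hE', add_zero, zero_add,
        Submodule.coe_inner]
    rw [← h1, ← h2, hg, hg, inner_smul_left, inner_smul_right, norm_mul, norm_mul, hF,
      RCLike.norm_conj, ha, ha, one_mul, one_mul]
  have hgn : ∀ ψ, ‖g ψ‖ = ‖ψ‖ := by
    intro ψ
    have := hone ψ ψ
    rw [inner_self_eq_norm_sq_to_K, inner_self_eq_norm_sq_to_K] at this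
    have h : ∀ r : ℝ, ‖(1 : ℂ) + (r : ℂ) ^ 2‖ = 1 + r ^ 2 := fun r => by
      rw [← Complex.ofReal_pow, ← Complex.ofReal_one, ← Complex.ofReal_add, Complex.norm_real,
        Real.norm_of_nonneg (by positivity)]
    have h3 : (1 : ℝ) + ‖g ψ‖ ^ 2 = 1 + ‖ψ‖ ^ 2 := by
      rw [← h, ← h]; exact this
    exact (sq_eq_sq₀ (norm_nonneg _) (norm_nonneg _)).1 (by linarith)
  have hgF : ∀ ψ, ∃ c : ℂ, ‖c‖ = 1 ∧ g ψ = c • F ψ := by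
    intro ψ
    refine exists_unit_smul_of_norm_inner_eq (by rw [hgn, hFn]; rfl) ?_
    have h0 : inner ℂ (F ψ) e' = 0 := norm_eq_zero.1 (by rw [hF, hE', norm_zero])
    have h1 : inner ℂ (F ψ) (e' + g ψ) = inner ℂ (F ψ) (g ψ) := by
      rw [inner_add_right, h0, zero_add]
    rw [← h1, hg, inner_smul_right, norm_mul, ha, one_mul, hF, inner_add_right, hE', zero_add,
      hFn, hgn, inner_self_eq_norm_sq_to_K]
    simp [sq]
  have hgi : ∀ ψ φ, ‖inner ℂ (g ψ) (g φ)‖ = ‖inner ℂ ψ φ‖ := by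
    intro ψ φ
    obtain ⟨c, hc, h⟩ := hgF ψ
    obtain ⟨d, hd, h'⟩ := hgF φ
    rw [h, h', inner_smul_left, inner_smul_right, norm_mul, norm_mul, hF, RCLike.norm_conj, hc, hd,
      one_mul, one_mul]
    rfl
  obtain ⟨σ, hσ, hadd, hsmul, hinner⟩ := semilinear_of_re_inner_eq (g := g)
    (fun x y => re_eq_of_norm_eq_of_norm_one_add_eq (hgi x y) (hone x y))
    (fun x => exists_unit_smul_of_norm_inner_eq
      (by rw [hgn, hgn, norm_smul, Complex.norm_I, one_mul])
      (by rw [hgi, hgn, hgn, inner_smul_right, inner_self_eq_norm_sq_to_K, norm_mul, norm_smul]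
          simp [sq]))
  have hσn : ∀ c, ‖σ c‖ = ‖c‖ := by
    rcases hσ with rfl | rfl
    · exact fun c => rfl
    · exact fun c => RCLike.norm_conj c
  have hσc : ∀ c, (starRingEnd ℂ) (σ c) = σ ((starRingEnd ℂ) c) := by
    rcases hσ with rfl | rfl <;> exact fun c => rfl
  let p : H →ₗ[ℂ] E := E.orthogonalProjectionOnto.toLinearMap
  have hp : ∀ x, x = inner ℂ e x • e + (p x : H) := by
    intro x
    have := Submodule.starProjection_add_starProjection_orthogonal (K := ℂ ∙ e) x
    rw [Submodule.starProjection_unit_singleton ℂ he] at this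
    exact this.symm
  let U : H → K := fun x => σ (inner ℂ e x) • e' + g (p x)
  have hUinner : ∀ x y, inner ℂ (U x) (U y) = σ (inner ℂ x y) := by
    intro x y
    have h2 : inner ℂ x y = (starRingEnd ℂ) (inner ℂ e x) * inner ℂ e y + inner ℂ (p x) (p y) := by
      conv_lhs => rw [hp x, hp y]
      simp only [inner_add_left, inner_add_right, inner_smul_left, inner_smul_right, hee, hE, hE',
        mul_zero, add_zero, zero_add, mul_one, Submodule.coe_inner]
      ring
    rw [h2]
    simp only [U, inner_add_left, inner_add_right, inner_smul_left, inner_smul_right, hee', hge,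
      hge', hinner, hσc, map_add, map_mul, mul_zero, add_zero, zero_add, mul_one]
    ring
  have hUn : ∀ x, ‖U x‖ = ‖x‖ := by
    intro x
    have := congrArg norm (hUinner x x)
    rw [hσn, inner_self_eq_norm_sq_to_K, inner_self_eq_norm_sq_to_K] at this
    simpa using this
  refine ⟨σ, U, hσ, fun x y => ?_, fun c x => ?_, hUinner, fun x => ?_⟩
  · simp only [U, inner_add_right, map_add, hadd, add_smul]
    abel
  · simp only [U, inner_smul_right, map_mul, map_smul, hsmul, mul_smul, smul_add]
  · refine exists_unit_smul_of_norm_inner_eq (by rw [hUn, hFn]) ?_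
    by_cases hx : inner ℂ e x = 0
    · have h1 : x = p x := by simpa [hx] using hp x
      obtain ⟨c, hc, h⟩ := hgF (p x)
      rw [hUn, hFn]
      simp only [U, hx, map_zero, zero_smul, zero_add]
      rw [h, ← h1, inner_smul_right, norm_mul, hc, one_mul, hF, inner_self_eq_norm_sq_to_K]
      simp [sq]
    · have h1 : U x = σ (inner ℂ e x) • a ((inner ℂ e x)⁻¹ • p x) •
          F ((inner ℂ e x)⁻¹ • x) := by
        have h2 : (inner ℂ e x)⁻¹ • x = e + (((inner ℂ e x)⁻¹ • p x : E) : H) := by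
          conv_lhs => rw [hp x]
          simp only [smul_add, inner_add_right, inner_smul_right, hee, hE, mul_one, add_zero,
            smul_smul, inv_mul_cancel₀ hx, one_smul, Submodule.coe_smul]
        rw [h2, ← hg, hsmul, smul_add, smul_smul, ← map_mul, mul_inv_cancel₀ hx, map_one, one_smul]
      rw [hUn, hFn, h1, inner_smul_right, inner_smul_right, norm_mul, norm_mul, ha, hF, hσn,
        inner_smul_right, norm_mul, one_mul, ← mul_assoc, ← norm_mul, mul_inv_cancel₀ hx,
        inner_self_eq_norm_sq_to_K]
      simp [sq]

section BornRule

variable {H : Type*} [NormedAddCommGroup H] [InnerProductSpace ℂ H]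

/-- The line spanned by a vector, as a closed subspace. -/
def closedLine (φ : H) : ClosedSubmodule ℂ H :=
  ⟨ℂ ∙ φ, (ℂ ∙ φ).closed_of_finiteDimensional⟩

theorem mk_eq_mk_of_mem_closedLine {φ χ : H} (hφ : φ ≠ 0) (hχ : χ ≠ 0)
    (h : φ ∈ (closedLine χ).toSubmodule) :
    Projectivization.mk ℂ φ hφ = Projectivization.mk ℂ χ hχ :=
  (Projectivization.mk_eq_mk_iff' ℂ _ _ _ _).2 (Submodule.mem_span_singleton.1 h)

variable [CompleteSpace H]

theorem bornProb_closedLine {φ : H} (hφ : φ ≠ 0) (ψ : H) :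
    bornProb ψ (closedLine φ) = (‖inner ℂ φ ψ‖ / (‖φ‖ * ‖ψ‖)) ^ 2 := by
  have h0 : ‖φ‖ ≠ 0 := norm_ne_zero_iff.2 hφ
  have h : (closedLine φ).toSubmodule.starProjection ψ =
      (inner ℂ φ ψ / ((‖φ‖ ^ 2 : ℝ) : ℂ)) • φ := Submodule.starProjection_singleton ℂ ψ
  have h' : ‖(closedLine φ).toSubmodule.starProjection ψ‖ = ‖inner ℂ φ ψ‖ / ‖φ‖ := by
    rw [h, norm_smul, norm_div, Complex.norm_real, Real.norm_of_nonneg (by positivity)]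
    field_simp
  rw [bornProb, h', ← div_pow, div_div]

theorem bornProb_eq_one_iff {ψ : H} (hψ : ψ ≠ 0) (S : ClosedSubmodule ℂ H) :
    bornProb ψ S = 1 ↔ ψ ∈ S.toSubmodule := by
  have h0 : ‖ψ‖ ≠ 0 := norm_ne_zero_iff.2 hψ
  rw [bornProb, div_eq_one_iff_eq (pow_ne_zero 2 h0), sq_eq_sq₀ (norm_nonneg _) (norm_nonneg _),
    S.toSubmodule.mem_iff_norm_starProjection]

theorem bornProb_bot (ψ : H) {S : ClosedSubmodule ℂ H} (hS : S.toSubmodule = ⊥) :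
    bornProb ψ S = 0 := by
  have : S.toSubmodule.starProjection ψ = 0 := by
    have h := S.toSubmodule.starProjection_apply_mem ψ
    exact (Submodule.eq_bot_iff _).1 hS _ h
  rw [bornProb, this]
  simp

end BornRule

section Morphism

variable {H K : Type*} [NormedAddCommGroup H] [InnerProductSpace ℂ H] [CompleteSpace H]
  [NormedAddCommGroup K] [InnerProductSpace ℂ K] [CompleteSpace K]
  (f : ChuSpace.Hom (quantumChu H) (quantumChu K))

/-- The map on rays of a morphism of quantum Chu spaces. -/
def ChuSpace.Hom.ray : ℙ ℂ H → ℙ ℂ K := f.onPoint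

/-- The map on closed subspaces of a morphism of quantum Chu spaces. -/
def ChuSpace.Hom.pullback : ClosedSubmodule ℂ K → ClosedSubmodule ℂ H := f.onAttr

theorem ChuSpace.Hom.bornProb_pullback {ψ : H} (hψ : ψ ≠ 0) {φ : K} (hφ : φ ≠ 0)
    (h : f.ray (.mk ℂ ψ hψ) = .mk ℂ φ hφ) (T : ClosedSubmodule ℂ K) :
    bornProb ψ (f.pullback T) = bornProb φ T := by
  have h1 : rayEval (.mk ℂ ψ hψ) (f.pullback T) = rayEval (f.ray (.mk ℂ ψ hψ)) T :=
    f.adj (.mk ℂ ψ hψ) T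
  rw [h] at h1
  exact congrArg Subtype.val h1

variable {f}

theorem ChuSpace.Hom.ray_of_mem_pullback {ψ : H} (hψ : ψ ≠ 0) {χ : K} (hχ : χ ≠ 0)
    (h : ψ ∈ (f.pullback (closedLine χ)).toSubmodule) :
    f.ray (.mk ℂ ψ hψ) = .mk ℂ χ hχ := by
  have hrep := (f.ray (.mk ℂ ψ hψ)).rep_nonzero
  have hmk := ((f.ray (.mk ℂ ψ hψ)).mk_rep).symm
  have h1 := f.bornProb_pullback hψ hrep hmk (closedLine χ)
  rw [(bornProb_eq_one_iff hψ _).2 h, eq_comm, bornProb_eq_one_iff hrep] at h1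
  rw [hmk]
  exact mk_eq_mk_of_mem_closedLine hrep hχ h1

theorem ChuSpace.Hom.pullback_closedLine (hf : Function.Injective f.ray) {ψ : H} (hψ : ψ ≠ 0)
    {φ : K} (hφ : φ ≠ 0) (h : f.ray (.mk ℂ ψ hψ) = .mk ℂ φ hφ) :
    f.pullback (closedLine φ) = closedLine ψ := by
  refine ClosedSubmodule.toSubmodule_injective (le_antisymm (fun χ hχ => ?_) ?_)
  · by_cases h0 : χ = 0
    · rw [h0]; exact zero_mem _
    have h1 := hf ((ChuSpace.Hom.ray_of_mem_pullback h0 hφ hχ).trans h.symm)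
    exact Submodule.mem_span_singleton.2 ((Projectivization.mk_eq_mk_iff' ℂ _ _ _ _).1 h1)
  · refine (Submodule.span_singleton_le_iff_mem _ _).2 ?_
    rw [← bornProb_eq_one_iff hψ, f.bornProb_pullback hψ hφ h, bornProb_eq_one_iff hφ]
    exact Submodule.mem_span_singleton_self φ

/-- An injective morphism of quantum Chu spaces preserves transition probabilities. -/
theorem ChuSpace.Hom.transition_eq (hf : Function.Injective f.ray) {ψ χ : H} (hψ : ψ ≠ 0)
    (hχ : χ ≠ 0) {ψ' χ' : K} (hψ' : ψ' ≠ 0) (hχ' : χ' ≠ 0)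
    (h : f.ray (.mk ℂ ψ hψ) = .mk ℂ ψ' hψ') (h' : f.ray (.mk ℂ χ hχ) = .mk ℂ χ' hχ') :
    ‖inner ℂ χ' ψ'‖ / (‖χ'‖ * ‖ψ'‖) = ‖inner ℂ χ ψ‖ / (‖χ‖ * ‖ψ‖) := by
  have h1 := f.bornProb_pullback hψ hψ' h (closedLine χ')
  rw [ChuSpace.Hom.pullback_closedLine hf hχ hχ' h', bornProb_closedLine hχ,
    bornProb_closedLine hχ'] at h1
  exact ((sq_eq_sq₀ (by positivity) (by positivity)).1 h1).symm

theorem ChuSpace.Hom.mem_range_ray_or_inner_eq_zero {χ : K} (hχ : χ ≠ 0) :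
    Projectivization.mk ℂ χ hχ ∈ Set.range f.ray ∨
      ∀ (φ : K) (hφ : φ ≠ 0), Projectivization.mk ℂ φ hφ ∈ Set.range f.ray → inner ℂ χ φ = 0 := by
  by_cases hS : (f.pullback (closedLine χ)).toSubmodule = ⊥
  · right
    rintro φ hφ ⟨x, hx⟩
    induction x with | h ψ hψ =>
    have h1 := f.bornProb_pullback hψ hφ hx (closedLine χ)
    rw [bornProb_bot ψ hS, bornProb_closedLine hχ, eq_comm, sq_eq_zero_iff, div_eq_zero_iff] at h1
    exact norm_eq_zero.1 (h1.resolve_right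
      (mul_ne_zero (norm_ne_zero_iff.2 hχ) (norm_ne_zero_iff.2 hφ)))
  · left
    obtain ⟨ψ, hψ, h0⟩ := (Submodule.ne_bot_iff _).1 hS
    exact ⟨_, ChuSpace.Hom.ray_of_mem_pullback h0 hχ hψ⟩

theorem ChuSpace.Hom.ray_surjective [Nontrivial H] : Function.Surjective f.ray := by
  obtain ⟨e, he⟩ := exists_ne (0 : H)
  have hφ := (f.ray (.mk ℂ e he)).rep_nonzero
  set φ := (f.ray (.mk ℂ e he)).rep with hφdef
  have hφr : Projectivization.mk ℂ φ hφ ∈ Set.range f.ray := ⟨_, (Projectivization.mk_rep _).symm⟩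
  intro y
  induction y with | h χ hχ =>
  rcases ChuSpace.Hom.mem_range_ray_or_inner_eq_zero (f := f) hχ with h | h
  · exact h
  exfalso
  have hφχ : inner ℂ φ χ = 0 := inner_eq_zero_symm.1 (h φ hφ hφr)
  have hsum : inner ℂ (φ + χ) φ ≠ 0 := by
    rw [inner_add_left, h φ hφ hφr, add_zero]
    exact inner_self_ne_zero.2 hφ
  have h0 : φ + χ ≠ 0 := fun h0 => hsum (by rw [h0, inner_zero_left])
  rcases ChuSpace.Hom.mem_range_ray_or_inner_eq_zero (f := f) h0 with h1 | h1
  · have := h _ h0 h1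
    rw [inner_add_right, h φ hφ hφr, zero_add] at this
    exact hχ (inner_self_eq_zero.1 this)
  · exact hsum (h1 φ hφ hφr)

/-- Vector representatives of the images of rays, with modulus of inner products preserved. -/
theorem ChuSpace.Hom.exists_norm_inner_eq (hf : Function.Injective f.ray) :
    ∃ F : H → K, (∀ x y, ‖inner ℂ (F x) (F y)‖ = ‖inner ℂ x y‖) ∧
      ∀ (x : H) (hx : x ≠ 0), ∃ h : F x ≠ 0, f.ray (.mk ℂ x hx) = .mk ℂ (F x) h := by
  have hex : ∀ x : H, ∃ k : K, ‖k‖ = ‖x‖ ∧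
      ∀ hx : x ≠ 0, ∃ h : k ≠ 0, f.ray (.mk ℂ x hx) = .mk ℂ k h := by
    intro x
    by_cases hx : x = 0
    · exact ⟨0, by simp [hx], fun h => absurd hx h⟩
    have hr := (f.ray (.mk ℂ x hx)).rep_nonzero
    set r := (f.ray (.mk ℂ x hx)).rep with hrdef
    have hr0 : ‖r‖ ≠ 0 := norm_ne_zero_iff.2 hr
    have hx0 : ‖x‖ ≠ 0 := norm_ne_zero_iff.2 hx
    have hc : ((‖x‖ / ‖r‖ : ℝ) : ℂ) ≠ 0 := Complex.ofReal_ne_zero.2 (div_ne_zero hx0 hr0)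
    refine ⟨((‖x‖ / ‖r‖ : ℝ) : ℂ) • r, ?_, fun _ => ⟨smul_ne_zero hc hr, ?_⟩⟩
    · rw [norm_smul, Complex.norm_real, Real.norm_of_nonneg (by positivity), div_mul_cancel₀ _ hr0]
    · rw [← Projectivization.mk_rep (f.ray (.mk ℂ x hx)), eq_comm]
      exact (Projectivization.mk_eq_mk_iff' ℂ _ _ _ _).2 ⟨_, rfl⟩
  choose F hFn hF using hex
  refine ⟨F, fun x y => ?_, hF⟩
  by_cases hx : x = 0
  · have : F x = 0 := norm_eq_zero.1 (by rw [hFn, hx, norm_zero])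
    rw [this, hx, inner_zero_left, inner_zero_left, norm_zero]
  by_cases hy : y = 0
  · have : F y = 0 := norm_eq_zero.1 (by rw [hFn, hy, norm_zero])
    rw [this, hy, inner_zero_right, inner_zero_right, norm_zero]
  obtain ⟨hx', hxF⟩ := hF x hx
  obtain ⟨hy', hyF⟩ := hF y hy
  have h := ChuSpace.Hom.transition_eq hf hy hx hy' hx' hyF hxF
  rw [hFn, hFn] at h
  exact (div_left_inj' (mul_ne_zero (norm_ne_zero_iff.2 hx) (norm_ne_zero_iff.2 hy))).1 h

end Morphism

/-- In dimension at least two, an additive map for which every vector is an eigenvector is a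
homothety. -/
theorem exists_forall_eq_smul {k V : Type*} [Field k] [AddCommGroup V] [Module k V]
    (hV : 1 < Module.rank k V) (W : V →+ V) (hW : ∀ y, ∃ c : k, W y = c • y) :
    ∃ c : k, ∀ y, W y = c • y := by
  have hindep : ∀ (x y : V) (c : k), x ≠ 0 → (∀ r : k, r • x ≠ y) → W x = c • x → W y = c • y := by
    intro x y c hx hxy hc
    obtain ⟨d, hd⟩ := hW y
    obtain ⟨s, hs⟩ := hW (x + y)
    rw [map_add, hc, hd, smul_add] at hs
    have hds : (c - s) • x = (s - d) • y := by
      rw [sub_smul, sub_smul, sub_eq_sub_iff_add_eq_add, hs, add_comm]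
    have h1 : s = d := by
      by_contra hne
      refine hxy ((s - d)⁻¹ * (c - s)) ?_
      rw [mul_smul, hds, inv_smul_smul₀ (sub_ne_zero.2 hne)]
    rw [h1, sub_self, zero_smul, smul_eq_zero_iff_left hx, sub_eq_zero] at hds
    rw [hd, hds]
  have hex : ∀ x : V, ∃ y : V, ∀ r : k, r • x ≠ y := by
    by_contra! h
    exact hV.not_ge (rank_le_one_iff.2 h)
  obtain ⟨e, he⟩ := hex 0
  have he0 : e ≠ 0 := fun h => he 0 (by rw [h, smul_zero])
  obtain ⟨c, hc⟩ := hW e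
  obtain ⟨z, hz⟩ := hex e
  have hz0 : z ≠ 0 := fun h => hz 0 (by rw [h, zero_smul])
  refine ⟨c, fun y => ?_⟩
  by_cases hy : ∃ r : k, r • e = y
  · obtain ⟨r, rfl⟩ := hy
    by_cases hr : r = 0
    · rw [hr, zero_smul, map_zero, smul_zero]
    refine hindep z _ c hz0 (fun s hs => ?_) (hindep e z c he0 hz hc)
    have hs0 : s ≠ 0 := by
      rintro rfl
      rw [zero_smul] at hs
      exact smul_ne_zero hr he0 hs.symm
    exact hz (s⁻¹ * r) (by rw [mul_smul, ← hs, inv_smul_smul₀ hs0])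
  · exact hindep e y c he0 (fun r hr => hy ⟨r, hr⟩) hc

section Semiunitary

variable {H K : Type*} [NormedAddCommGroup H] [InnerProductSpace ℂ H]
  [NormedAddCommGroup K] [InnerProductSpace ℂ K] {U V : H → K}

theorem IsSemiunitaryWith.of_surjective {σ : ℂ →+* ℂ} (hadd : ∀ x y, U (x + y) = U x + U y)
    (hsmul : ∀ (c : ℂ) x, U (c • x) = σ c • U x)
    (hinner : ∀ x y, inner ℂ (U x) (U y) = σ (inner ℂ x y)) (hU : Function.Surjective U) :
    IsSemiunitaryWith σ U := by
  refine ⟨⟨?_, hU⟩, hadd, hsmul, hinner⟩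
  refine (injective_iff_map_eq_zero (AddMonoidHom.mk' U hadd)).2 fun x hx => ?_
  have h1 := hinner x x
  have h2 : U x = 0 := hx
  rw [h2, inner_zero_left, eq_comm, map_eq_zero] at h1
  exact inner_self_eq_zero.1 h1

theorem IsSemiunitary.bijective (hU : IsSemiunitary U) : Function.Bijective U :=
  hU.elim (fun h => IsSemiunitaryWith.bijective h) fun h => IsSemiunitaryWith.bijective h

theorem IsSemiunitary.map_add (hU : IsSemiunitary U) (x y : H) : U (x + y) = U x + U y :=
  hU.elim (fun h => IsSemiunitaryWith.map_add h x y) fun h => IsSemiunitaryWith.map_add h x y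

theorem IsSemiunitaryWith.norm_map {σ : ℂ →+* ℂ} (hσ : ∀ c, ‖σ c‖ = ‖c‖)
    (hU : IsSemiunitaryWith σ U) (x : H) : ‖U x‖ = ‖x‖ := by
  have := congrArg norm (hU.inner_map x x)
  rw [hσ, inner_self_eq_norm_sq_to_K, inner_self_eq_norm_sq_to_K] at this
  simpa using this

theorem IsSemiunitary.norm_map (hU : IsSemiunitary U) (x : H) : ‖U x‖ = ‖x‖ :=
  hU.elim (fun h => IsSemiunitaryWith.norm_map (fun _ => rfl) h x)
    fun h => IsSemiunitaryWith.norm_map RCLike.norm_conj h x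

theorem IsSemiunitary.rayMap_mk (hU : IsSemiunitary U) {x : H} (hx : x ≠ 0) :
    hU.rayMap (.mk ℂ x hx) = .mk ℂ (U x) (hU.map_ne_zero hx) := rfl

theorem IsSemiunitaryWith.unit_smul {σ : ℂ →+* ℂ} (hU : IsSemiunitaryWith σ U) {c : ℂ}
    (hc : ‖c‖ = 1) : IsSemiunitaryWith σ (c • U) := by
  have hc0 : c ≠ 0 := norm_ne_zero_iff.1 (by rw [hc]; exact one_ne_zero)
  refine IsSemiunitaryWith.of_surjective (fun x y => ?_) (fun a x => ?_) (fun x y => ?_) fun y => ?_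
  · simp only [Pi.smul_apply, hU.map_add, smul_add]
  · simp only [Pi.smul_apply, hU.map_smul, smul_comm c]
  · simp only [Pi.smul_apply, inner_smul_left, inner_smul_right, hU.inner_map, ← mul_assoc]
    rw [mul_comm c, RCLike.conj_mul, hc]
    simp
  · obtain ⟨x, hx⟩ := hU.bijective.2 (c⁻¹ • y)
    exact ⟨x, by rw [Pi.smul_apply, hx, smul_inv_smul₀ hc0]⟩

theorem IsSemiunitary.unit_smul (hU : IsSemiunitary U) {c : ℂ} (hc : ‖c‖ = 1) :
    IsSemiunitary (c • U) :=
  hU.imp (fun h => IsSemiunitaryWith.unit_smul h hc) fun h => IsSemiunitaryWith.unit_smul h hc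

theorem IsSemiunitary.rayMap_unit_smul (hU : IsSemiunitary U) {c : ℂ} (hc : ‖c‖ = 1) :
    (hU.unit_smul hc).rayMap = hU.rayMap := by
  funext x
  induction x with | h x hx =>
  exact (Projectivization.mk_eq_mk_iff' ℂ _ _ _ _).2 ⟨c, rfl⟩

/-- In dimension at least two, semiunitaries that induce the same map on rays differ by a phase. -/
theorem IsSemiunitary.eq_unit_smul_of_rayMap_eq (hK : 1 < Module.rank ℂ K) (hU : IsSemiunitary U)
    (hV : IsSemiunitary V) (h : hU.rayMap = hV.rayMap) :
    ∃ c : ℂ, ‖c‖ = 1 ∧ ∀ x, V x = c • U x := by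
  have hVU : ∀ x, ∃ c : ℂ, V x = c • U x := by
    intro x
    by_cases hx : x = 0
    · refine ⟨0, ?_⟩
      rw [zero_smul, hx]
      exact (AddMonoidHom.mk' V hV.map_add).map_zero
    · have h1 := congrFun h.symm (.mk ℂ x hx)
      rw [hU.rayMap_mk, hV.rayMap_mk] at h1
      obtain ⟨c, hc⟩ := (Projectivization.mk_eq_mk_iff' ℂ _ _ _ _).1 h1
      exact ⟨c, hc.symm⟩
  let e : H ≃+ K := AddEquiv.ofBijective (AddMonoidHom.mk' U hU.map_add) hU.bijective
  have he : ∀ x, e x = U x := fun x => rfl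
  obtain ⟨c, hc⟩ := exists_forall_eq_smul hK
    ((AddMonoidHom.mk' V hV.map_add).comp e.symm.toAddMonoidHom) fun y => by
      obtain ⟨c, hc⟩ := hVU (e.symm y)
      refine ⟨c, ?_⟩
      rwa [← he, e.apply_symm_apply] at hc
  have hVc : ∀ x, V x = c • U x := fun x => by
    have := hc (e x)
    rwa [AddMonoidHom.comp_apply, AddEquiv.coe_toAddMonoidHom, e.symm_apply_apply] at this
  refine ⟨c, ?_, hVc⟩
  have : Nontrivial K := rank_pos_iff_nontrivial.1 (zero_le_one.trans_lt hK)
  obtain ⟨y, hy⟩ := exists_ne (0 : K)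
  obtain ⟨x, rfl⟩ := hU.bijective.2 y
  have h1 := congrArg norm (hVc x)
  rw [norm_smul, hV.norm_map, ← hU.norm_map] at h1
  exact (mul_eq_right₀ (norm_ne_zero_iff.2 hy)).1 h1.symm

end Semiunitary

theorem exists_isSemiunitary_ray_eq {H K : Type*}
    [NormedAddCommGroup H] [InnerProductSpace ℂ H] [CompleteSpace H] [Nontrivial H]
    [NormedAddCommGroup K] [InnerProductSpace ℂ K] [CompleteSpace K]
    (f : ChuSpace.Hom (quantumChu H) (quantumChu K)) (hf : Function.Injective f.ray) :
    ∃ (U : H → K) (hU : IsSemiunitary U), f.ray = hU.rayMap := by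
  obtain ⟨F, hF, hFray⟩ := ChuSpace.Hom.exists_norm_inner_eq hf
  obtain ⟨e, he⟩ := exists_norm_eq H zero_le_one
  obtain ⟨σ, U, hσ, hadd, hsmul, hinner, hUF⟩ :=
    exists_semilinear_isometry_of_norm_inner_eq F hF e he
  have hσs : Function.Surjective σ := by
    rcases hσ with rfl | rfl
    · exact Function.surjective_id
    · exact star_involutive.surjective
  have hsurj : Function.Surjective U := by
    intro y
    by_cases hy : y = 0
    · exact ⟨0, by rw [hy]; exact (AddMonoidHom.mk' U hadd).map_zero⟩
    obtain ⟨x, hx⟩ := ChuSpace.Hom.ray_surjective (f := f) (.mk ℂ y hy)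
    induction x with | h x hx0 =>
    obtain ⟨hx', hxF⟩ := hFray x hx0
    obtain ⟨a, ha⟩ := (Projectivization.mk_eq_mk_iff' ℂ _ _ _ _).1 (hx.symm.trans hxF)
    obtain ⟨c, hc, hcU⟩ := hUF x
    have hc0 : c ≠ 0 := norm_ne_zero_iff.1 (by rw [hc]; exact one_ne_zero)
    obtain ⟨b, hb⟩ := hσs (a * c⁻¹)
    exact ⟨b • x, by rw [hsmul, hb, hcU, mul_smul, inv_smul_smul₀ hc0, ha]⟩
  have hU : IsSemiunitary U := by
    rcases hσ with rfl | rfl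
    · exact Or.inl (IsSemiunitaryWith.of_surjective hadd hsmul hinner hsurj)
    · exact Or.inr (IsSemiunitaryWith.of_surjective hadd hsmul hinner hsurj)
  refine ⟨U, hU, funext fun x => ?_⟩
  induction x with | h x hx =>
  obtain ⟨hx', hxF⟩ := hFray x hx
  obtain ⟨c, -, hcU⟩ := hUF x
  rw [hxF, hU.rayMap_mk, eq_comm]
  exact (Projectivization.mk_eq_mk_iff' ℂ _ _ _ _).2 ⟨c, hcU.symm⟩

theorem theorem3 {H K : Type*}
    [NormedAddCommGroup H] [InnerProductSpace ℂ H] [CompleteSpace H]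
    [NormedAddCommGroup K] [InnerProductSpace ℂ K] [CompleteSpace K]
    (hH : 2 < Module.rank ℂ H) (hK : 2 < Module.rank ℂ K)
    (f : ChuSpace.Hom (quantumChu H) (quantumChu K))
    (hf : Function.Injective f.onPoint) :
    ∃ (U : H → K) (hU : IsSemiunitary U), f.onPoint = hU.rayMap ∧
      ∀ V : H → K, (∃ hV : IsSemiunitary V, f.onPoint = hV.rayMap) ↔
        ∃ c : ℂ, ‖c‖ = 1 ∧ ∀ ψ : H, V ψ = c • U ψ := by
  have : Nontrivial H := rank_pos_iff_nontrivial.1 (zero_le.trans_lt hH)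
  obtain ⟨U, hU, h⟩ := exists_isSemiunitary_ray_eq f hf
  refine ⟨U, hU, h, fun V => ⟨?_, ?_⟩⟩
  · rintro ⟨hV, hV'⟩
    exact hU.eq_unit_smul_of_rayMap_eq (Cardinal.one_lt_two.trans hK) hV (h.symm.trans hV')
  · rintro ⟨c, hc, hcV⟩
    obtain rfl : V = c • U := funext hcV
    exact ⟨hU.unit_smul hc, h.trans (hU.rayMap_unit_smul hc).symm⟩
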